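/- Let $\mathcal H$ be a complex Hilbert space, and let $A_0,A_1,A_2,\dots$ be bounded self-adjoint operators on $\mathcal H$ such that, for some $r>0$, the series $$A(t)=A_0+tA_1+t^2A_2+\cdots$$ converges absolutely in operator norm for all real $t$ with $|t|<r$. Suppose that $0$ is an isolated point of the spectrum $\sigma(A_0)$ (the kernel of $A_0$ may be infinite-dimensional), and let $P$ be the orthogonal projection onto $\ker A_0$. Let $\mu$ be an element of the discrete spectrum of $PA_1P$, regarded as an operator on the Hilbert space $\ker A_0$, with multiplicity $k$; that is, $\mu$ is an isolated point of the spectrum of this operator and an eigenvalue whose eigenspace has finite dimension $k$. Then there are an open interval $I\subseteq(-r,r)$ containing $0$, real-analytic functions $x_1,\dots,x_k\colon I\to\mathcal H$, and functions $\lambda_1,\dots,\lambda_k\colon I\to\mathbb R$ such that, for every $t\in I$, the vectors $x_1(t),\dots,x_k(t)$ are mutually orthogonal unit vectors with $$A(t)x_j(t)=\lambda_j(t)x_j(t)\qquad(1\le j\le k),$$ and such that, for all $1\le j\le k$, $\lambda_j(0)=0$ and $\lambda_j$ is differentiable at $0$ with $\lambda_j'(0)=\mu$. -/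

import Mathlib

open Set Filter Topology

/-- `A(t) = a 0 + t a 1 + t² a 2 + ⋯` for real `|t| < r`, where the coefficients are bounded
self-adjoint operators and the series converges absolutely in operator norm for `|t| < r`. -/
structure IsSelfAdjointHolomorphicFamily {H : Type*} [NormedAddCommGroup H]
    [InnerProductSpace ℂ H] [CompleteSpace H]
    (A : ℝ → H →L[ℂ] H) (a : ℕ → H →L[ℂ] H) (r : ℝ) : Prop where
  radius_pos : 0 < r
  selfAdjoint : ∀ n, IsSelfAdjoint (a n)
  summable_norm : ∀ t : ℝ, |t| < r → Summable fun n => ‖t ^ n • a n‖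
  hasSum : ∀ t : ℝ, |t| < r → HasSum (fun n => t ^ n • a n) (A t)

/-- `z` is an isolated element of the set `s`. -/
def IsIsolatedElement {X : Type*} [TopologicalSpace X] (z : X) (s : Set X) : Prop :=
  z ∈ s ∧ ∃ U : Set X, IsOpen U ∧ z ∈ U ∧ U ∩ s = {z}

/-- The compression `P T P` of `T`, regarded as an operator on the closed subspace `K`,
where `P` is the orthogonal projection onto `K`. -/
noncomputable def compression {H : Type*} [NormedAddCommGroup H] [InnerProductSpace ℂ H]
    (K : Submodule ℂ H) [K.HasOrthogonalProjection] (T : H →L[ℂ] H) : K →L[ℂ] K :=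
  K.orthogonalProjectionOnto ∘L T ∘L K.subtypeL

/-- On `K`, the compression agrees with the operator product `P T P`. -/
theorem coe_compression_apply {H : Type*} [NormedAddCommGroup H] [InnerProductSpace ℂ H]
    (K : Submodule ℂ H) [K.HasOrthogonalProjection] (T : H →L[ℂ] H) (x : K) :
    (compression K T x : H) = (K.starProjection * T * K.starProjection) (x : H) := by
  simp [compression]

/-- `μ` belongs to the discrete spectrum of `T` with multiplicity `k`: it is an isolated element
of the spectrum and an eigenvalue whose eigenspace has finite dimension `k`. -/
structure IsDiscreteEigenvalue {E : Type*} [NormedAddCommGroup E] [NormedSpace ℂ E]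
    (T : E →L[ℂ] E) (μ : ℂ) (k : ℕ) : Prop where
  isolated : IsIsolatedElement μ (spectrum ℂ T)
  hasEigenvalue : Module.End.HasEigenvalue (T : E →ₗ[ℂ] E) μ
  finiteDimensional : FiniteDimensional ℂ (Module.End.eigenspace (T : E →ₗ[ℂ] E) μ)
  finrank_eq : Module.finrank ℂ (Module.End.eigenspace (T : E →ₗ[ℂ] E) μ) = k

/-! Let `p` project onto the `μ`-eigenspace of the compression of `A₁` to `ker A₀`, `q` onto the
rest of `ker A₀`, and let `Q = 1 - p - q`. Write `A(t) = A₀ + t C(t)` with `C` analytic and `C(0) =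
A₁`. Isolation of `0` makes `A₀` invertible on the range of `Q`; isolation of `μ` makes `q A₁ q - μ`
invertible on the range of `q`.

An invariant subspace near the range of `p` is sought as a graph `V = p + qZ + tQZ`. Because the
`Q`-part carries a factor `t`, one `t` cancels from `A(t) V = t V Λ`. The resulting equation for `Z`
has, at `t = 0`, a block triangular invertible derivative, so the implicit function theorem solves
it analytically (`exists_analyticAt_invariant`). This needs only Banach algebra, and the range of
`p` may have any dimension.

The frame `V` is then completed to unitaries `U(t)` (`exists_analyticAt_unitary_of_frame`), which
turn `A(t)` on the invariant subspace into `t B(t)`, with `B` analytic, self-adjoint and `B(0) = μ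
p`. Since the eigenspace has dimension `k`, Rellich's theorem
(`exists_analyticAt_orthonormal_eigenvectors`) gives analytic orthonormal eigenvectors `v` of
`B(t)`. Then `U(t) v` are eigenvectors of `A(t)` with eigenvalues `t ⟨v, B(t) v⟩`, which vanish at
`0` with derivative `μ`. Rellich's theorem is itself proved by induction on dimension, from the same
reduction with `a = 0`. -/

/-- Analytic implicit function theorem with an invertible partial derivative. -/
theorem AnalyticAt.exists_implicitFunction {E F : Type*} [NormedAddCommGroup E] [NormedSpace ℝ E]
    [CompleteSpace E] [NormedAddCommGroup F] [NormedSpace ℝ F] [CompleteSpace F]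
    {f : ℝ × E → F} {z : E} {t : ℝ} (hf : AnalyticAt ℝ f (t, z)) (e : E ≃L[ℝ] F)
    (he : HasFDerivAt (fun y => f (t, y)) (e : E →L[ℝ] F) z) :
    ∃ g : ℝ → E, AnalyticAt ℝ g t ∧ g t = z ∧ ∀ᶠ s in 𝓝 t, f (s, g s) = f (t, z) := by
  have hc : ContDiffAt ℝ (⊤ : WithTop ℕ∞) f (t, z) := hf.contDiffAt
  have hd : fderiv ℝ f (t, z) ∘L .inr ℝ ℝ E = (e : E →L[ℝ] F) :=
    (hf.differentiableAt.hasFDerivAt.comp z (hasFDerivAt_prodMk_right t z)).unique he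
  have hi : (fderiv ℝ f (t, z) ∘L .inr ℝ ℝ E).IsInvertible := ⟨e, hd.symm⟩
  exact ⟨hc.implicitFunction (by simp) hi, (hc.contDiffAt_implicitFunction (by simp) hi).analyticAt,
    hc.implicitFunction_apply_self (by simp) hi, hc.eventually_apply_implicitFunction (by simp) hi⟩

/-! ### Square roots and invariant graphs in a Banach algebra -/

section BanachAlgebra

variable {𝔸 : Type*} [NormedRing 𝔸] [NormedAlgebra ℝ 𝔸]

/-- Left multiplication by a unit as a continuous linear equivalence. -/
noncomputable def mulLeftContinuousEquiv (u : 𝔸ˣ) : 𝔸 ≃L[ℝ] 𝔸 :=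
  ContinuousLinearEquiv.equivOfInverse (ContinuousLinearMap.mul ℝ 𝔸 u)
    (ContinuousLinearMap.mul ℝ 𝔸 ↑u⁻¹) (fun x => by simp) (fun x => by simp)

theorem coe_mulLeftContinuousEquiv_apply (u : 𝔸ˣ) (x : 𝔸) :
    (mulLeftContinuousEquiv u : 𝔸 →L[ℝ] 𝔸) x = u * x := rfl

/-- An analytic square root near `1` that is unique near `1`. -/
theorem exists_analyticAt_sqrt_one (𝔸 : Type*) [NormedRing 𝔸] [NormedAlgebra ℝ 𝔸]
    [CompleteSpace 𝔸] :
    ∃ s : 𝔸 → 𝔸, AnalyticAt ℝ s 1 ∧ s 1 = 1 ∧ (∀ᶠ g in 𝓝 (1 : 𝔸), s g * s g = g) ∧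
      ∀ᶠ y in 𝓝 (1 : 𝔸), s (y * y) = y := by
  have hf : ContDiffAt ℝ (⊤ : WithTop ℕ∞) (fun y : 𝔸 => y * y) 1 := by fun_prop
  let u : 𝔸ˣ := Units.map (algebraMap ℝ 𝔸).toMonoidHom (Units.mk0 (2 : ℝ) two_ne_zero)
  have hd : HasFDerivAt (fun y : 𝔸 => y * y) (mulLeftContinuousEquiv u : 𝔸 →L[ℝ] 𝔸) 1 := by
    refine ((hasFDerivAt_id (1 : 𝔸)).mul' (hasFDerivAt_id (1 : 𝔸))).congr_fderiv ?_
    ext x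
    simp [coe_mulLeftContinuousEquiv_apply, u]
    rw [map_ofNat, two_mul]
  have hs := hf.hasStrictFDerivAt' hd (by simp)
  refine ⟨hf.localInverse hd (by simp), ?_, ?_, ?_, hs.eventually_left_inverse⟩
  · simpa using (hf.to_localInverse hd (by simp)).analyticAt
  · simpa using hf.localInverse_apply_image hd (by simp)
  · have := hs.eventually_right_inverse
    simp only [mul_one] at this
    exact this

/-- Reduction of an analytic family `a + t C(t)` to the range of the idempotent `p`, where
`p + q + Q = 1`, the operator `a` is invertible on the range of `Q` with inverse `S`, and
`q C(0) q - μ` is invertible on the range of `q` with inverse `R`. -/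
theorem exists_analyticAt_invariant [CompleteSpace 𝔸] {p q Q a S R : 𝔸} {C : ℝ → 𝔸} {μ : ℝ}
    (hC : AnalyticAt ℝ C 0) (hsum : p + q + Q = 1)
    (hpp : p * p = p) (hqq : q * q = q)
    (hpq : p * q = 0) (hqp : q * p = 0)
    (hpa : p * a = 0) (hap : a * p = 0) (hqa : q * a = 0) (haq : a * q = 0)
    (haS : a * S = Q) (hSa : S * a = Q) (hQS : Q * S = S) (hSQ : S * Q = S)
    (hpC : p * C 0 * p = μ • p) (hqC : q * C 0 * p = 0)
    (hqR : q * R = R) (hRq : R * q = R)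
    (hR : (q * C 0 * q - μ • q) * R = q) (hR' : R * (q * C 0 * q - μ • q) = q) :
    ∃ V Λ : ℝ → 𝔸, AnalyticAt ℝ V 0 ∧ AnalyticAt ℝ Λ 0 ∧ V 0 = p ∧ Λ 0 = μ • p ∧
      ∀ᶠ t in 𝓝 0, p * V t = p ∧ V t * p = V t ∧ p * Λ t = Λ t ∧ Λ t * p = Λ t ∧
        (a + t • C t) * V t = t • (V t * Λ t) := by
  have hQ : Q = 1 - p - q := by rw [← hsum]; abel
  have hpQ : p * Q = 0 := by rw [hQ]; simp [mul_sub, hpp, hpq]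
  have hQp : Q * p = 0 := by rw [hQ]; simp [sub_mul, hpp, hqp]
  have hqQ : q * Q = 0 := by rw [hQ]; simp [mul_sub, hqq, hqp]
  have hQq : Q * q = 0 := by rw [hQ]; simp [sub_mul, hqq, hpq]
  have hQQ : Q * Q = Q := by nth_rw 1 [hQ]; simp [sub_mul, hpQ, hqQ]
  have hQa : Q * a = a := by rw [hQ]; simp [sub_mul, hpa, hqa]
  have haQ : a * Q = a := by rw [hQ]; simp [mul_sub, hap, haq]
  have hpR : p * R = 0 := by rw [← hqR, ← mul_assoc, hpq, zero_mul]
  have hRp : R * p = 0 := by rw [← hRq, mul_assoc, hqp, mul_zero]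
  have hRQ : R * Q = 0 := by rw [← hRq, mul_assoc, hqQ, mul_zero]
  have hpS : p * S = 0 := by rw [← hQS, ← mul_assoc, hpQ, zero_mul]
  have hSp : S * p = 0 := by rw [← hSQ, mul_assoc, hQp, mul_zero]
  have hqS : q * S = 0 := by rw [← hQS, ← mul_assoc, hqQ, zero_mul]
  have hSq : S * q = 0 := by rw [← hSQ, mul_assoc, hQq, mul_zero]
  have haR : a * R = 0 := by rw [← hqR, ← mul_assoc, haq, zero_mul]
  have hRa : R * a = 0 := by rw [← hRq, mul_assoc, hqa, mul_zero]
  -- This will be the derivative of `F` in `Z`. With respect to `p, q, Q` it is triangular: diagonal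
  -- blocks `p`, `q C(0) q - μ q`, `a`, and one off-diagonal block `Q C(0) q`. The inverse comes
  -- from block elimination.
  let L : 𝔸ˣ :=
    { val := p + (q * C 0 * q - μ • q) + a + Q * C 0 * q
      inv := p + R + S - S * C 0 * R
      val_inv := by
        have h1 : (q * C 0 * q - μ • q) * p = 0 := by simp [sub_mul, mul_assoc, hqp]
        have h2 : (q * C 0 * q - μ • q) * S = 0 := by simp [sub_mul, mul_assoc, hqS]
        have h3 : Q * C 0 * q * R = Q * C 0 * R := by rw [mul_assoc, hqR]
        have h4 : a * (S * C 0 * R) = Q * C 0 * R := by simp only [← mul_assoc, haS]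
        have h5 : p * (S * C 0 * R) = 0 := by simp only [← mul_assoc, hpS, zero_mul]
        have h6 : (q * C 0 * q - μ • q) * (S * C 0 * R) = 0 := by
          simp only [← mul_assoc, h2, zero_mul]
        have h7 : Q * C 0 * q * (S * C 0 * R) = 0 := by
          rw [mul_assoc S, ← mul_assoc, mul_assoc _ q S, hqS]; simp
        have h8 : Q * C 0 * q * p = 0 := by rw [mul_assoc, hqp, mul_zero]
        have h9 : Q * C 0 * q * S = 0 := by rw [mul_assoc, hqS, mul_zero]
        simp only [mul_add, add_mul, mul_sub, h1, h2, h3, h4, h5, h6, h7, h8, h9, hR, hpp, hap,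
          hpR, hpS, haR, haS]
        rw [← hsum]; abel
      inv_val := by
        have h1 : p * (q * C 0 * q - μ • q) = 0 := by simp [mul_sub, ← mul_assoc, hpq]
        have h2 : S * (q * C 0 * q - μ • q) = 0 := by simp [mul_sub, ← mul_assoc, hSq]
        have h3 : S * (Q * C 0 * q) = S * C 0 * q := by simp only [← mul_assoc, hSQ]
        have h4 : S * C 0 * R * (q * C 0 * q - μ • q) = S * C 0 * q := by rw [mul_assoc, hR']
        have h5 : S * C 0 * R * p = 0 := by rw [mul_assoc, hRp, mul_zero]
        have h6 : S * C 0 * R * a = 0 := by rw [mul_assoc, hRa, mul_zero]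
        have h7 : S * C 0 * R * (Q * C 0 * q) = 0 := by
          rw [mul_assoc Q, ← mul_assoc, mul_assoc _ R Q, hRQ]; simp
        have h8 : p * (Q * C 0 * q) = 0 := by simp only [← mul_assoc, hpQ, zero_mul]
        have h9 : R * (Q * C 0 * q) = 0 := by simp only [← mul_assoc, hRQ, zero_mul]
        simp only [mul_add, add_mul, sub_mul _ (S * C 0 * R), h1, h2, h3, h4, h5, h6, h7, h8, h9,
          hR', hpp, hpa, hRp, hSp, hRa, hSa]
        rw [← hsum]; abel }
  let V : ℝ × 𝔸 → 𝔸 := fun x => p + q * x.2 + x.1 • (Q * x.2)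
  let Λ : ℝ × 𝔸 → 𝔸 := fun x => p * C x.1 * V x * p
  -- The three components encode the normalization `pZ = 0`, the `q`-equation, and the `Q`-equation
  -- divided by `t`. The term `μ (1 - p)` completes `Λ = μ p` to the scalar `μ` at the base point,
  -- so the derivative is a left multiplication; it disappears after multiplying by `p` on the
  -- right.
  let F : ℝ × 𝔸 → 𝔸 := fun x => p * x.2 + q * C x.1 * V x - q * x.2 * (Λ x + μ • (1 - p))
    + a * x.2 + Q * C x.1 * V x - x.1 • (Q * x.2 * Λ x)
  -- At `t = 0` the `Q`-equation reads `a Z = -Q C(0) p`; `S` inverts `a` there.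
  set Z₀ : 𝔸 := -(S * C 0 * p) with hZ₀
  have hqZ : q * Z₀ = 0 := by simp [hZ₀, ← mul_assoc, hqS]
  have hpZ : p * Z₀ = 0 := by simp [hZ₀, ← mul_assoc, hpS]
  have haZ : a * Z₀ = -(Q * C 0 * p) := by simp [hZ₀, ← mul_assoc, haS]
  have hV0 : V (0, Z₀) = p := by simp [V, hqZ]
  have hC1 : AnalyticAt ℝ (fun x : ℝ × 𝔸 => C x.1) (0, Z₀) :=
    AnalyticAt.fun_comp (g := C) (f := Prod.fst) hC analyticAt_fst
  have hfst : AnalyticAt ℝ (fun x : ℝ × 𝔸 => x.1) (0, Z₀) := analyticAt_fst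
  have hsnd : AnalyticAt ℝ (fun x : ℝ × 𝔸 => x.2) (0, Z₀) := analyticAt_snd
  have hV : AnalyticAt ℝ V (0, Z₀) := by
    simp only [V]; fun_prop
  have hΛ : AnalyticAt ℝ Λ (0, Z₀) := by
    simp only [Λ]; fun_prop
  have hF : AnalyticAt ℝ F (0, Z₀) := by
    simp only [F]; fun_prop
  have hF0 : F (0, Z₀) = 0 := by
    simp [F, hV0, hqZ, hpZ, haZ, hqC]
  -- Differentiability of `Λ` suffices: its derivative enters only multiplied by `q Z₀ = 0`.
  have hd : HasFDerivAt (fun y => F (0, y)) (mulLeftContinuousEquiv L : 𝔸 →L[ℝ] 𝔸) Z₀ := by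
    have hid := hasFDerivAt_id (𝕜 := ℝ) Z₀
    have hVd : HasFDerivAt (fun y => V (0, y)) (q • ContinuousLinearMap.id ℝ 𝔸) Z₀ := by
      simpa [V] using (hid.const_mul q).const_add p
    have hΛd : DifferentiableAt ℝ (fun y => Λ (0, y)) Z₀ :=
      (hΛ.differentiableAt.comp Z₀ (hasFDerivAt_prodMk_right (0 : ℝ) Z₀).differentiableAt)
    have := ((((hid.const_mul p).add (hVd.const_mul (q * C 0))).sub
      ((hid.const_mul q).mul' (hΛd.hasFDerivAt.add_const (μ • (1 - p))))).add
      (hid.const_mul a)).add (hVd.const_mul (Q * C 0))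
    have hF' : (fun y => F (0, y)) = fun y => p * y + q * C 0 * V (0, y)
        - q * y * (Λ (0, y) + μ • (1 - p)) + a * y + Q * C 0 * V (0, y) := by
      ext y; simp [F]
    rw [hF']
    refine HasFDerivAt.congr_fderiv this ?_
    ext y
    have hΛ0 : Λ (0, Z₀) = μ • p := by
      simp only [Λ, hV0, mul_assoc, hpp]
      simpa only [mul_assoc] using hpC
    simp [coe_mulLeftContinuousEquiv_apply, L, hqZ, hΛ0, mul_assoc, add_mul, sub_mul, ← smul_add]
    abel
  obtain ⟨Z, hZ, hZ0, hZF⟩ := hF.exists_implicitFunction _ hd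
  have hg : AnalyticAt ℝ (fun t => (t, Z t)) 0 := analyticAt_id.prod hZ
  have hVa : AnalyticAt ℝ (fun t => V (t, Z t)) 0 :=
    AnalyticAt.fun_comp (g := V) (f := fun t => (t, Z t)) (by simpa [hZ0] using hV) hg
  have hΛa : AnalyticAt ℝ (fun t => Λ (t, Z t)) 0 :=
    AnalyticAt.fun_comp (g := Λ) (f := fun t => (t, Z t)) (by simpa [hZ0] using hΛ) hg
  refine ⟨fun t => V (t, Z t) * p, fun t => Λ (t, Z t), hVa.mul analyticAt_const, hΛa, ?_, ?_, ?_⟩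
  · simp [hZ0, hV0, hpp]
  · simp [hZ0, Λ, hV0, mul_assoc, hpp]
    simpa [mul_assoc] using hpC
  filter_upwards [hZF] with t ht
  rw [hF0] at ht
  have hpV : p * V (t, Z t) = p := by
    simp [V, mul_add, ← mul_assoc, hpp, hpq, hpQ]
  have hpΛ : p * Λ (t, Z t) = Λ (t, Z t) := by
    simp only [Λ, ← mul_assoc, hpp]
  have hΛp : Λ (t, Z t) * p = Λ (t, Z t) := by
    simp only [Λ, mul_assoc, hpp]
  have hqF : q * C t * V (t, Z t) * p = q * Z t * Λ (t, Z t) := by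
    have h := congrArg (fun x => q * x * p) ht
    simp only [F, mul_add, mul_sub, add_mul, sub_mul, ← mul_assoc, hqp, hqq, hqa, hqQ, zero_mul,
      mul_smul_comm, smul_mul_assoc, mul_zero, mul_one, smul_zero] at h
    simp only [mul_assoc, hΛp, hpp] at h
    simp only [mul_assoc]
    exact sub_eq_zero.mp (by simpa using h)
  have hQF : a * (Z t * p) + Q * C t * V (t, Z t) * p = t • (Q * Z t * Λ (t, Z t)) := by
    have h := congrArg (fun x => Q * x * p) ht
    simp only [F, mul_add, mul_sub, add_mul, sub_mul, ← mul_assoc, hQp, hQq, hQa, hQQ, zero_mul,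
      mul_smul_comm, smul_mul_assoc, mul_zero, mul_one] at h
    simp only [mul_assoc, hΛp] at h
    simp only [mul_assoc]
    exact sub_eq_zero.mp (by simpa using h)
  refine ⟨by rw [← mul_assoc, hpV, hpp], by rw [mul_assoc, hpp], hpΛ, hΛp, ?_⟩
  have haV : a * V (t, Z t) = t • (a * Z t) := by
    simp [V, mul_add, ← mul_assoc, hap, haq, haQ]
  have hCV : C t * V (t, Z t) * p = Λ (t, Z t) + q * Z t * Λ (t, Z t) + Q * C t * V (t, Z t) * p := by
    rw [← hqF]
    simp only [Λ, ← add_mul, hsum, one_mul]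
  have hVΛ : V (t, Z t) * p * Λ (t, Z t)
      = Λ (t, Z t) + q * Z t * Λ (t, Z t) + t • (Q * Z t * Λ (t, Z t)) := by
    rw [mul_assoc, hpΛ]
    simp only [V, add_mul, hpΛ, smul_mul_assoc]
  rw [hVΛ, ← hQF, add_mul, ← mul_assoc, haV, smul_mul_assoc, smul_mul_assoc, ← mul_assoc, hCV,
    ← smul_add, mul_assoc a]
  congr 1
  abel

end BanachAlgebra

/-! ### From an invariant frame to analytic unitaries -/

section StarAlgebra

variable {𝔸 : Type*} [NormedRing 𝔸]

/-- If `φ` fixes `g`, then `φ (s g)` is again a square root of `g` near `1`, so local uniqueness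
forces it to equal `s g`. Symmetries of `g` thus pass to its square root. -/
theorem eventually_fixed_sqrt {s : 𝔸 → 𝔸} (hs : ContinuousAt s 1) (hs1 : s 1 = 1)
    (hsq : ∀ᶠ g in 𝓝 (1 : 𝔸), s g * s g = g) (huniq : ∀ᶠ y in 𝓝 (1 : 𝔸), s (y * y) = y)
    {φ : 𝔸 → 𝔸} (hφ : Continuous φ) (hφ1 : φ 1 = 1) (hφm : ∀ x, φ (x * x) = φ x * φ x) :
    ∀ᶠ g in 𝓝 (1 : 𝔸), φ g = g → φ (s g) = s g := by
  have ht : Tendsto (fun g => φ (s g)) (𝓝 1) (𝓝 1) := by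
    have := hφ.continuousAt.tendsto.comp hs.tendsto
    simpa [hs1, hφ1, Function.comp_def] using this
  filter_upwards [hsq, ht.eventually huniq] with g h1 h2 h3
  rw [← hφm, h1, h3] at h2
  exact h2.symm

variable [NormedAlgebra ℝ 𝔸] [StarRing 𝔸] [ContinuousStar 𝔸] [StarModule ℝ 𝔸]

theorem AnalyticAt.star_real {f : ℝ → 𝔸} {t : ℝ} (hf : AnalyticAt ℝ f t) :
    AnalyticAt ℝ (fun s => star (f s)) t :=
  AnalyticAt.fun_comp (((starL' ℝ : 𝔸 ≃L[ℝ] 𝔸) : 𝔸 →L[ℝ] 𝔸).analyticAt _) hf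

/-- Completion of an analytic frame `V` over the range of a self-adjoint idempotent `p` to an
analytic family of unitaries. -/
theorem exists_analyticAt_unitary_of_frame [CompleteSpace 𝔸] {p : 𝔸} {V : ℝ → 𝔸} (hp : IsSelfAdjoint p)
    (hpp : p * p = p) (hV : AnalyticAt ℝ V 0) (hV0 : V 0 = p)
    (hpV : ∀ᶠ t in 𝓝 0, p * V t = p ∧ V t * p = V t) :
    ∃ U Y Y' : ℝ → 𝔸, AnalyticAt ℝ U 0 ∧ AnalyticAt ℝ Y 0 ∧ AnalyticAt ℝ Y' 0 ∧ U 0 = 1 ∧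
      Y 0 = 1 ∧ Y' 0 = 1 ∧ ∀ᶠ t in 𝓝 0, star (U t) * U t = 1 ∧ U t * star (U t) = 1 ∧
        Y t * Y' t = 1 ∧ Y' t * Y t = 1 ∧ Commute p (Y t) ∧ Commute p (Y' t) ∧
        U t * p = V t * Y' t := by
  obtain ⟨s, hs, hs1, hsq, huniq⟩ := exists_analyticAt_sqrt_one 𝔸
  have hstar := eventually_fixed_sqrt hs.continuousAt hs1 hsq huniq (φ := star) continuous_star
    (star_one _) (fun x => star_mul x x)
  have hr : ((2 : ℝ) • p - 1) * ((2 : ℝ) • p - 1) = 1 := by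
    simp only [sub_mul, mul_sub, smul_mul_assoc, mul_smul_comm, hpp, mul_one, one_mul]
    module
  -- Invariance under conjugation by the reflection `2p - 1` is the same as commuting with `p`.
  have hconj := eventually_fixed_sqrt hs.continuousAt hs1 hsq huniq
    (φ := fun x => ((2 : ℝ) • p - 1) * x * ((2 : ℝ) • p - 1)) (by fun_prop) (by simpa using hr)
    (fun x => by
      generalize (2 : ℝ) • p - 1 = r at hr
      calc r * (x * x) * r = r * x * 1 * x * r := by simp only [mul_one, mul_assoc]
        _ = r * x * r * (r * x * r) := by rw [← hr]; simp only [mul_assoc])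
  -- `K` is skew-adjoint with `K p = V - p`, so `(1 + K) p = V` and `star (1 + K) * (1 + K) = 1 -
  -- K²`. As `(V - p)² = 0`, `K²` commutes with `p`; dividing `1 + K` by the square root of `1 - K²`
  -- gives a unitary that still carries the range of `p` to that of `V`.
  let K : ℝ → 𝔸 := fun t => (V t - p) - star (V t - p)
  have hK : AnalyticAt ℝ K 0 := by
    have h1 : AnalyticAt ℝ (fun t => V t - p) 0 := hV.sub analyticAt_const
    exact h1.sub h1.star_real
  have hK0 : K 0 = 0 := by simp [K, hV0]
  let G : ℝ → 𝔸 := fun t => 1 - K t * K t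
  have hG : AnalyticAt ℝ G 0 := analyticAt_const.sub (hK.mul hK)
  have hG0 : G 0 = 1 := by simp [G, hK0]
  have hGt : Tendsto G (𝓝 0) (𝓝 1) := hG0 ▸ hG.continuousAt.tendsto
  let Y : ℝ → 𝔸 := fun t => s (G t)
  have hY : AnalyticAt ℝ Y 0 := AnalyticAt.fun_comp (g := s) (f := G) (hG0 ▸ hs) hG
  have hY0 : Y 0 = 1 := by simp [Y, hG0, hs1]
  let Y' : ℝ → 𝔸 := fun t => Ring.inverse (Y t)
  have hY' : AnalyticAt ℝ Y' 0 := by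
    refine AnalyticAt.fun_comp (g := Ring.inverse) (f := Y) ?_ hY
    rw [hY0]
    exact analyticAt_inverse (1 : 𝔸ˣ)
  have hY'0 : Y' 0 = 1 := by simp [Y', hY0]
  let U : ℝ → 𝔸 := fun t => (1 + K t) * Y' t
  have hU : AnalyticAt ℝ U 0 := (analyticAt_const.add hK).mul hY'
  have hU0 : U 0 = 1 := by simp [U, hK0, hY'0]
  have hunit : ∀ᶠ x in 𝓝 (1 : 𝔸), IsUnit x := Units.isOpen.mem_nhds isUnit_one
  have hYt : Tendsto Y (𝓝 0) (𝓝 1) := hY0 ▸ hY.continuousAt.tendsto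
  have hUt : Tendsto U (𝓝 0) (𝓝 1) := hU0 ▸ hU.continuousAt.tendsto
  refine ⟨U, Y, Y', hU, hY, hY', hU0, hY0, hY'0, ?_⟩
  filter_upwards [hpV, hGt.eventually hstar, hGt.eventually hconj, hGt.eventually hsq,
    hYt.eventually hunit, hUt.eventually hunit] with t ⟨hpV, hVp⟩ hstar hconj hsq hYu hUu
  have hKs : star (K t) = -K t := by simp [K]
  have hX1 : p * (V t - p) = 0 := by rw [mul_sub, hpV, hpp, sub_self]
  have hX2 : (V t - p) * p = V t - p := by rw [sub_mul, hVp, hpp]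
  have hX3 : star (V t - p) * p = 0 := by
    have := congrArg star hX1
    rwa [star_mul, hp.star_eq, star_zero] at this
  have hX4 : p * star (V t - p) = star (V t - p) := by
    have := congrArg star hX2
    rwa [star_mul, hp.star_eq] at this
  have hKp : K t * p = V t - p := by simp only [K]; rw [sub_mul, hX2, hX3, sub_zero]
  have hpK : p * K t = -star (V t - p) := by simp only [K]; rw [mul_sub, hX1, hX4, zero_sub]
  have hXX : (V t - p) * (V t - p) = 0 := by
    nth_rw 1 [← hX2]; rw [mul_assoc, hX1, mul_zero]
  have hXX' : star (V t - p) * star (V t - p) = 0 := by rw [← star_mul, hXX, star_zero]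
  have hKK : K t * K t * p = p * (K t * K t) := by
    rw [mul_assoc, hKp, ← mul_assoc, hpK]
    simp only [K]
    rw [sub_mul, hXX, neg_mul, mul_sub (star (V t - p)) (V t - p) (star (V t - p)), hXX']
    abel
  have hGp : G t * p = p * G t := by
    rw [show G t = 1 - K t * K t from rfl, sub_mul, hKK, mul_sub p, one_mul, mul_one]
  have hYs : star (Y t) = Y t := hstar (by simp [G, hKs])
  have hYr : ((2 : ℝ) • p - 1) * Y t * ((2 : ℝ) • p - 1) = Y t := by
    refine hconj ?_
    have : ((2 : ℝ) • p - 1) * G t = G t * ((2 : ℝ) • p - 1) := by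
      simp [sub_mul, mul_sub, hGp]
    rw [this, mul_assoc, hr, mul_one]
  have hpY : Commute p (Y t) := by
    have h1 : ((2 : ℝ) • p - 1) * Y t = Y t * ((2 : ℝ) • p - 1) := by
      nth_rw 2 [← hYr]
      rw [mul_assoc _ (_ - _) (_ - _), hr, mul_one]
    simp only [sub_mul, mul_sub, smul_mul_assoc, mul_smul_comm, one_mul, mul_one,
      sub_left_inj] at h1
    exact smul_right_injective 𝔸 (two_ne_zero (α := ℝ)) h1
  have hYY' : Y t * Y' t = 1 := Ring.mul_inverse_cancel _ hYu
  have hY'Y : Y' t * Y t = 1 := Ring.inverse_mul_cancel _ hYu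
  have hpY' : p * Y' t = Y' t * p := by
    calc p * Y' t = Y' t * Y t * p * Y' t := by rw [hY'Y, one_mul]
      _ = Y' t * p * (Y t * Y' t) := by rw [mul_assoc _ (Y t) p, ← hpY.eq]; simp only [mul_assoc]
      _ = Y' t * p := by rw [hYY', mul_one]
  have hY's : star (Y' t) = Y' t := by
    have : star (Y' t) * Y t = 1 := by rw [← hYs, ← star_mul, hYY', star_one]
    exact left_inv_eq_right_inv this hYY'
  have hUU : star (U t) * U t = 1 := by
    have hG' : (1 - K t) * (1 + K t) = Y t * Y t := by
      rw [show Y t * Y t = G t from hsq]; simp only [G]; noncomm_ring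
    calc star (U t) * U t = Y' t * ((1 - K t) * (1 + K t)) * Y' t := by
          simp [U, hKs, hY's, sub_eq_add_neg, mul_assoc]
      _ = 1 := by rw [hG', ← mul_assoc, hY'Y, one_mul, hYY']
  refine ⟨hUU, ?_, hYY', hY'Y, hpY, hpY', ?_⟩
  · obtain ⟨u, hu⟩ := hUu
    rw [← hu] at hUU ⊢
    rw [left_inv_eq_right_inv hUU u.mul_inv, u.mul_inv]
  · simp only [U]
    rw [mul_assoc, ← hpY', ← mul_assoc, add_mul, hKp, one_mul, add_sub_cancel]

/-- Reduction of a self-adjoint analytic family `a + t C(t)` to the range of the idempotent `p` by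
an analytic family of unitaries. -/
theorem exists_analyticAt_unitary_reduction [CompleteSpace 𝔸] {p q Q a S R : 𝔸} {C : ℝ → 𝔸} {μ : ℝ}
    (hC : AnalyticAt ℝ C 0) (hsum : p + q + Q = 1)
    (hpp : p * p = p) (hqq : q * q = q)
    (hpq : p * q = 0) (hqp : q * p = 0)
    (hpa : p * a = 0) (hap : a * p = 0) (hqa : q * a = 0) (haq : a * q = 0)
    (haS : a * S = Q) (hSa : S * a = Q) (hQS : Q * S = S) (hSQ : S * Q = S)
    (hpC : p * C 0 * p = μ • p) (hqC : q * C 0 * p = 0)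
    (hqR : q * R = R) (hRq : R * q = R)
    (hR : (q * C 0 * q - μ • q) * R = q) (hR' : R * (q * C 0 * q - μ • q) = q)
    (hp : IsSelfAdjoint p) (hsa : ∀ᶠ t in 𝓝 (0 : ℝ), IsSelfAdjoint (a + t • C t)) :
    ∃ U B : ℝ → 𝔸, AnalyticAt ℝ U 0 ∧ AnalyticAt ℝ B 0 ∧ U 0 = 1 ∧ B 0 = μ • p ∧
      ∀ᶠ t in 𝓝 0, star (U t) * U t = 1 ∧ U t * star (U t) = 1 ∧ p * B t = B t ∧
        B t * p = B t ∧ IsSelfAdjoint (B t) ∧ (a + t • C t) * U t * p = t • (U t * B t) := by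
  obtain ⟨V, Λ, hV, hΛ, hV0, hΛ0, hev⟩ := exists_analyticAt_invariant hC hsum hpp hqq hpq hqp hpa hap
    hqa haq haS hSa hQS hSQ hpC hqC hqR hRq hR hR'
  obtain ⟨U, Y, Y', hU, hY, hY', hU0, hY0, hY'0, hev'⟩ :=
    exists_analyticAt_unitary_of_frame hp hpp hV hV0 (hev.mono fun t h => ⟨h.1, h.2.1⟩)
  refine ⟨U, fun t => Y t * Λ t * Y' t, hU, (hY.mul hΛ).mul hY', hU0, ?_, ?_⟩
  · simp [hY0, hY'0, hΛ0]
  filter_upwards [hev, hev', hsa] with t ⟨_, _, hpΛ, hΛp, hAV⟩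
    ⟨hU1, hU2, _, hY'Y, hpY, hpY', hUp⟩ hsa
  have hpB : p * (Y t * Λ t * Y' t) = Y t * Λ t * Y' t := by
    rw [← mul_assoc, ← mul_assoc, hpY.eq, mul_assoc (Y t), hpΛ]
  have hBp : Y t * Λ t * Y' t * p = Y t * Λ t * Y' t := by
    rw [mul_assoc, ← hpY'.eq, ← mul_assoc, mul_assoc (Y t), hΛp]
  have hAU : (a + t • C t) * U t * p = t • (U t * (Y t * Λ t * Y' t)) := by
    have h1 : U t * Y t * Λ t = V t * Λ t := by
      calc U t * Y t * Λ t = U t * (Y t * p) * Λ t := by simp only [mul_assoc, hpΛ]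
        _ = U t * p * Y t * Λ t := by rw [← hpY.eq]; simp only [mul_assoc]
        _ = V t * Λ t := by rw [hUp, mul_assoc (V t), hY'Y, mul_one]
    rw [mul_assoc, hUp, ← mul_assoc, hAV, smul_mul_assoc, ← h1]
    simp only [mul_assoc]
  refine ⟨hU1, hU2, hpB, hBp, ?_, hAU⟩
  -- For `t ≠ 0`, `t B(t)` is a compression of a unitary conjugate of the self-adjoint family; at `t
  -- = 0` the value is `μ p`.
  rcases eq_or_ne t 0 with rfl | ht
  · simp only [hY0, hY'0, hΛ0, one_mul, mul_one]
    exact (IsSelfAdjoint.all μ).smul hp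
  · have h2 : t • (Y t * Λ t * Y' t) = p * (star (U t) * (a + t • C t) * U t) * p := by
      calc t • (Y t * Λ t * Y' t) = p * star (U t) * (t • (U t * (Y t * Λ t * Y' t))) := by
            rw [mul_smul_comm, mul_assoc p, ← mul_assoc (star _), hU1, one_mul, hpB]
        _ = _ := by rw [← hAU]; simp only [mul_assoc]
    have h3 : IsSelfAdjoint (t • (Y t * Λ t * Y' t)) := by
      rw [h2]
      have := (hsa.conjugate' (U t)).conjugate p
      rwa [hp.star_eq] at this
    have h4 := (IsSelfAdjoint.all t⁻¹).smul h3
    rwa [smul_smul, inv_mul_cancel₀ ht, one_smul] at h4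

end StarAlgebra

/-- `b + e` is block diagonal with block `e` on the corner of `e`; subtracting `e` from its inverse
leaves the inverse of `b` on the complementary corner. -/
theorem exists_corner_inverse {R : Type*} [Ring R] {b e : R} (hee : e * e = e) (hbe : b * e = 0)
    (heb : e * b = 0) (hu : IsUnit (b + e)) :
    ∃ s, b * s = 1 - e ∧ s * b = 1 - e ∧ e * s = 0 ∧ s * e = 0 := by
  obtain ⟨u, hu⟩ := hu
  have h1 : (u : R) * e = e := by rw [hu, add_mul, hbe, hee, zero_add]
  have h2 : e * (u : R) = e := by rw [hu, mul_add, heb, hee, zero_add]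
  have h3 : (↑u⁻¹ : R) * e = e := by rw [Units.inv_mul_eq_iff_eq_mul, h1]
  have h4 : e * (↑u⁻¹ : R) = e := by rw [Units.mul_inv_eq_iff_eq_mul, h2]
  have hb : b = u - e := by rw [hu, add_sub_cancel_right]
  refine ⟨↑u⁻¹ - e, ?_, ?_, ?_, ?_⟩
  · rw [hb, sub_mul, mul_sub, mul_sub, u.mul_inv, h1, h4, hee]; abel
  · rw [hb, sub_mul, mul_sub, mul_sub, u.inv_mul, h2, h3, hee]; abel
  · rw [mul_sub, h4, hee, sub_self]
  · rw [sub_mul, h3, hee, sub_self]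

/-! ### Self-adjoint operators, isolated spectral points and reduced resolvents -/

section Hilbert

variable {H : Type*} [NormedAddCommGroup H] [InnerProductSpace ℂ H]

/-- The parameter is real while the operators are complex linear, so evaluation is used as a real
bilinear map. -/
theorem AnalyticAt.complexCLM_apply {F : Type*} [NormedAddCommGroup F] [NormedSpace ℂ F]
    {U : ℝ → H →L[ℂ] F} {y : ℝ → H} {t : ℝ} (hU : AnalyticAt ℝ U t) (hy : AnalyticAt ℝ y t) :
    AnalyticAt ℝ (fun s => U s (y s)) t :=
  AnalyticAt.fun_comp (g := fun x : (H →L[ℂ] F) × H => x.1 x.2) (f := fun s => (U s, y s))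
    (((ContinuousLinearMap.id ℂ (H →L[ℂ] F)).bilinearRestrictScalars ℝ).analyticAt_bilinear _)
    (hU.prod hy)

theorem AnalyticAt.clm_conj {G : Type*} [NormedAddCommGroup G] [NormedSpace ℂ G]
    (J : G →L[ℂ] H) (P : H →L[ℂ] G) {T : ℝ → H →L[ℂ] H} {t : ℝ} (hT : AnalyticAt ℝ T t) :
    AnalyticAt ℝ (fun s => P ∘L T s ∘L J) t :=
  AnalyticAt.fun_comp (g := fun X : H →L[ℂ] H => P ∘L X ∘L J)
    ((((ContinuousLinearMap.compL ℂ G H G P) ∘L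
      ((ContinuousLinearMap.compL ℂ G H H).flip J)).restrictScalars ℝ).analyticAt _) hT

theorem inner_compression_left (K : Submodule ℂ H) [K.HasOrthogonalProjection]
    (T : H →L[ℂ] H) (x y : K) :
    inner ℂ (compression K T x) y = inner ℂ (T x) (y : H) := by
  simp [compression]

theorem inner_compression_right (K : Submodule ℂ H) [K.HasOrthogonalProjection]
    (T : H →L[ℂ] H) (x y : K) :
    inner ℂ x (compression K T y) = inner ℂ (x : H) (T y) := by
  simp [compression]

theorem mul_starProjection_eq_zero {T : H →L[ℂ] H} {K : Submodule ℂ H} [K.HasOrthogonalProjection]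
    (h : ∀ x ∈ K, T x = 0) : T * K.starProjection = 0 := by
  ext x
  exact h _ (K.starProjection_apply_mem x)

variable [CompleteSpace H]

theorem IsSelfAdjoint.inner_apply_eq {T : H →L[ℂ] H} (hT : IsSelfAdjoint T) (x y : H) :
    inner ℂ (T x) y = inner ℂ x (T y) :=
  ContinuousLinearMap.isSelfAdjoint_iff_isSymmetric.mp hT x y

theorem IsSelfAdjoint.compression {K : Submodule ℂ H} [K.HasOrthogonalProjection] [CompleteSpace K]
    {T : H →L[ℂ] H} (hT : IsSelfAdjoint T) : IsSelfAdjoint (compression K T) := by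
  rw [ContinuousLinearMap.isSelfAdjoint_iff_isSymmetric]
  intro x y
  change inner ℂ (_root_.compression K T x) y = inner ℂ x (_root_.compression K T y)
  rw [inner_compression_left, inner_compression_right, hT.inner_apply_eq]

theorem IsSelfAdjoint.starProjection_mul_eq_zero {T : H →L[ℂ] H} (hT : IsSelfAdjoint T)
    {K : Submodule ℂ H} [K.HasOrthogonalProjection]
    (h : ∀ x ∈ K, T x = 0) : K.starProjection * T = 0 := by
  have := congrArg star (mul_starProjection_eq_zero h)
  rwa [star_mul, hT.star_eq, (isSelfAdjoint_starProjection K).star_eq, star_zero] at this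

/-- At an isolated point `z` of its spectrum, a self-adjoint operator `T` satisfies: `T - z` plus
the orthogonal projection onto the kernel of `T - z` is invertible. -/
theorem IsSelfAdjoint.isUnit_sub_add_starProjection {T : H →L[ℂ] H} (hT : IsSelfAdjoint T) {z : ℝ}
    (hz : IsIsolatedElement (z : ℂ) (spectrum ℂ T)) (N : Submodule ℂ H) [N.HasOrthogonalProjection]
    (hN : ∀ x, x ∈ N ↔ T x = (z : ℂ) • x) :
    IsUnit (T - (z : ℂ) • (1 : H →L[ℂ] H) + N.starProjection) := by
  classical
  obtain ⟨-, U, hU, hzU, hUs⟩ := hz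
  have hn : IsStarNormal T := hT.isStarNormal
  -- Isolation makes this indicator continuous on the spectrum, so `f(T)` is available by continuous
  -- functional calculus. The function `(x - z) + f x` never vanishes, which gives invertibility; it
  -- remains to identify `f(T)` with the projection onto `N`.
  let f : ℂ → ℂ := fun x => if x = z then 1 else 0
  have hf : ContinuousOn f (spectrum ℂ T) := by
    intro x hx
    by_cases hxz : x = z
    · have : f =ᶠ[𝓝[spectrum ℂ T] x] fun _ => 1 := by
        filter_upwards [mem_nhdsWithin_of_mem_nhds (hU.mem_nhds (hxz ▸ hzU)),
          self_mem_nhdsWithin] with y hyU hys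
        have : y ∈ ({(z : ℂ)} : Set ℂ) := hUs ▸ ⟨hyU, hys⟩
        simp only [f, if_pos (show y = z from this)]
      exact continuousWithinAt_const.congr_of_eventuallyEq this (by simp [f, hxz])
    · have : f =ᶠ[𝓝 x] fun _ => 0 := by
        filter_upwards [isOpen_ne.mem_nhds hxz] with y hy
        simp only [f, if_neg hy]
      exact (continuousAt_const.congr this.symm).continuousWithinAt
  have hid : cfc (fun x : ℂ => x - z) T = T - (z : ℂ) • (1 : H →L[ℂ] H) := by
    rw [cfc_sub .., cfc_id' ℂ T, cfc_const (z : ℂ) T, Algebra.algebraMap_eq_smul_one]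
  have hsum : cfc (fun x => (x - z) + f x) T = T - (z : ℂ) • (1 : H →L[ℂ] H) + cfc f T := by
    rw [cfc_add .., hid]
  have hprod : (T - (z : ℂ) • (1 : H →L[ℂ] H)) * cfc f T = 0 := by
    rw [← hid, ← cfc_mul ..]
    have : (fun x : ℂ => (x - z) * f x) = fun _ => 0 := by
      ext x; by_cases hx : x = z <;> simp [f, hx]
    rw [this, cfc_const_zero]
  have hsq : cfc f T * cfc f T = cfc f T := by
    rw [← cfc_mul ..]
    congr 1
    ext x; by_cases hx : x = z <;> simp [f, hx]
  have hu : IsUnit (T - (z : ℂ) • (1 : H →L[ℂ] H) + cfc f T) := by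
    rw [← hsum, isUnit_cfc_iff ..]
    intro x _
    by_cases hx : x = z
    · simp [f, hx]
    · simpa [f, hx] using sub_ne_zero.mpr hx
  have hsa : IsSelfAdjoint (cfc f T) := by
    rw [IsSelfAdjoint, ← cfc_star]
    congr 1
    ext x; by_cases hx : x = z <;> simp [f, hx]
  have hmem : ∀ x, cfc f T x ∈ N := fun x => by
    have := congrArg (fun S : H →L[ℂ] H => S x) hprod
    rw [hN]
    simpa [sub_eq_zero] using this
  -- Both `x` and `f(T) x` lie in the kernel of `T - z`, and the injective operator `T - z + f(T)`
  -- sends both to `f(T) x`.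
  have hfix : ∀ x ∈ N, cfc f T x = x := fun x hx => by
    have hinj := (ContinuousLinearMap.isUnit_iff_bijective.mp hu).injective
    apply hinj
    have h1 : (cfc f T * cfc f T) x = cfc f T x := by rw [hsq]
    have h2 := (hN _).mp (hmem x)
    have h3 := (hN _).mp hx
    simp only [mul_apply_eq_comp] at h1
    simp [h1, h2, h3]
  have hproj : N.starProjection = cfc f T := by
    ext x
    refine Submodule.eq_starProjection_of_mem_of_inner_eq_zero (hmem x) fun w hw => ?_
    rw [inner_sub_left, hsa.inner_apply_eq, hfix w hw, sub_self]
  rwa [hproj]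

theorem IsSelfAdjoint.sub_ofReal_smul_one {T : H →L[ℂ] H} (hT : IsSelfAdjoint T) (μ : ℝ) :
    IsSelfAdjoint (T - (μ : ℂ) • (1 : H →L[ℂ] H)) :=
  hT.sub (IsSelfAdjoint.smul (Complex.conj_ofReal μ) (.one _))

/-- The reduced resolvent of a self-adjoint operator at an eigenvalue. -/
theorem IsSelfAdjoint.exists_reduced_resolvent {T : H →L[ℂ] H} (hT : IsSelfAdjoint T) {μ : ℝ}
    {N : Submodule ℂ H} [N.HasOrthogonalProjection] (hN : ∀ x ∈ N, T x = (μ : ℂ) • x)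
    (hu : IsUnit (T - (μ : ℂ) • (1 : H →L[ℂ] H) + N.starProjection)) :
    ∃ s, N.starProjection * T * N.starProjection = (μ : ℂ) • N.starProjection ∧
      (1 - N.starProjection) * T * N.starProjection = 0 ∧ (1 - N.starProjection) * s = s ∧
      s * (1 - N.starProjection) = s ∧
      ((1 - N.starProjection) * T * (1 - N.starProjection) - (μ : ℂ) • (1 - N.starProjection)) * s
        = 1 - N.starProjection ∧
      s * ((1 - N.starProjection) * T * (1 - N.starProjection) - (μ : ℂ) • (1 - N.starProjection))
        = 1 - N.starProjection := by
  have hee : N.starProjection * N.starProjection = N.starProjection :=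
    N.isIdempotentElem_starProjection
  have hbN : ∀ x ∈ N, (T - (μ : ℂ) • (1 : H →L[ℂ] H)) x = 0 := fun x hx => by simp [hN x hx]
  have hbe := mul_starProjection_eq_zero hbN
  have heb := (hT.sub_ofReal_smul_one μ).starProjection_mul_eq_zero hbN
  generalize N.starProjection = e at *
  obtain ⟨s, hs1, hs2, hs3, hs4⟩ := exists_corner_inverse hee hbe heb hu
  have hq : (1 - e) * (1 - e) = 1 - e := by
    rw [mul_sub, mul_one, sub_mul, one_mul, hee, sub_self, sub_zero]
  have hqb : (1 - e) * T * (1 - e) - (μ : ℂ) • (1 - e) = T - (μ : ℂ) • (1 : H →L[ℂ] H) := by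
    have h : (1 - e) * (T - (μ : ℂ) • (1 : H →L[ℂ] H)) * (1 - e) = T - (μ : ℂ) • (1 : H →L[ℂ] H) := by
      rw [sub_mul 1 e (T - _), one_mul, heb, sub_zero, mul_sub _ 1 e, mul_one, hbe, sub_zero]
    rwa [mul_sub (1 - e) T, mul_smul_comm, mul_one, sub_mul _ ((μ : ℂ) • (1 - e)) (1 - e),
      smul_mul_assoc, hq] at h
  rw [sub_mul, smul_mul_assoc, one_mul, sub_eq_zero] at hbe
  refine ⟨s, ?_, ?_, ?_, ?_, ?_, ?_⟩
  · rw [mul_assoc, hbe, mul_smul_comm, hee]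
  · rw [mul_assoc, hbe, mul_smul_comm, sub_mul, one_mul, hee, sub_self, smul_zero]
  · rw [sub_mul, hs3, one_mul, sub_zero]
  · rw [mul_sub, hs4, mul_one, sub_zero]
  · rw [hqb, hs1]
  · rw [hqb, hs2]

end Hilbert

/-! ### Rellich's theorem in finite dimension -/

section Rellich

variable {H : Type*} [NormedAddCommGroup H] [InnerProductSpace ℂ H]

theorem Orthonormal.sumElim_orthogonal {ι κ : Type*} {K : Submodule ℂ H} {v : ι → K} {w : κ → Kᗮ}
    (hv : Orthonormal ℂ v) (hw : Orthonormal ℂ w) :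
    Orthonormal ℂ (Sum.elim (fun i => (v i : H)) (fun i => (w i : H))) := by
  refine ⟨?_, ?_⟩
  · rintro (i | i)
    · exact hv.1 i
    · exact hw.1 i
  · rintro (i | i) (j | j) hij
    · exact hv.2 (fun h => hij (h ▸ rfl))
    · exact K.inner_right_of_mem_orthogonal (v i).2 (w j).2
    · exact K.inner_left_of_mem_orthogonal (v j).2 (w i).2
    · exact hw.2 (fun h => hij (h ▸ rfl))

variable [CompleteSpace H]

theorem inner_apply_apply_of_star_mul_self {U : H →L[ℂ] H} (hU : star U * U = 1) (x y : H) :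
    inner ℂ (U x) (U y) = inner ℂ x y := by
  rw [← ContinuousLinearMap.adjoint_inner_left, ← ContinuousLinearMap.star_eq_adjoint,
    ← ContinuousLinearMap.comp_apply, ← ContinuousLinearMap.mul_def, hU, one_apply_eq_self]

theorem Orthonormal.of_star_mul_self {ι : Type*} {U : H →L[ℂ] H} (hU : star U * U = 1) {v : ι → H}
    (hv : Orthonormal ℂ v) : Orthonormal ℂ fun i => U (v i) := by
  classical
  rw [orthonormal_iff_ite] at hv ⊢
  intro i j
  rw [inner_apply_apply_of_star_mul_self hU, hv]

/-- In finite dimension, an analytic family of self-adjoint operators is block diagonalized over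
the eigenspace `M` of its value at `0` by an analytic family of unitaries. -/
theorem exists_analyticAt_unitary_commute [FiniteDimensional ℂ H] {C : ℝ → H →L[ℂ] H}
    (hC : AnalyticAt ℝ C 0) (hsa : ∀ᶠ t in 𝓝 0, IsSelfAdjoint (C t)) (μ : ℝ) (M : Submodule ℂ H)
    (hM : ∀ x, x ∈ M ↔ C 0 x = (μ : ℂ) • x) :
    ∃ U : ℝ → H →L[ℂ] H, AnalyticAt ℝ U 0 ∧ ∀ᶠ t in 𝓝 0, star (U t) * U t = 1 ∧
      U t * star (U t) = 1 ∧ Commute M.starProjection (star (U t) * C t * U t) := by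
  set p := M.starProjection
  have hp : IsSelfAdjoint p := isSelfAdjoint_starProjection M
  have hpp : p * p = p := M.isIdempotentElem_starProjection
  have hsa0 : IsSelfAdjoint (C 0) := hsa.self_of_nhds
  let b : H →L[ℂ] H := C 0 - (μ : ℂ) • (1 : H →L[ℂ] H)
  have hbM : ∀ x, x ∈ M ↔ b x = 0 := fun x => by simp [hM, b, sub_eq_zero]
  have hpb : p * b = 0 := (hsa0.sub_ofReal_smul_one μ).starProjection_mul_eq_zero
    fun x hx => (hbM x).mp hx
  have hu : IsUnit (b + p) := by
    rw [ContinuousLinearMap.isUnit_iff_bijective]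
    have hinj : Function.Injective (b + p) := by
      rw [injective_iff_map_eq_zero]
      intro x hx
      have h1 : p x = 0 := by
        have h : (p * (b + p)) x = 0 := by simp [mul_apply_eq_comp, hx]
        rwa [mul_add, hpb, hpp, zero_add] at h
      have h2 : b x = 0 := by simpa [h1] using hx
      rw [← h1, Submodule.starProjection_eq_self_iff.mpr ((hbM x).mpr h2)]
    exact ⟨hinj, (LinearMap.injective_iff_surjective (f := ((b + p : H →L[ℂ] H) : H →ₗ[ℂ] H))).mp
      hinj⟩
  obtain ⟨R, hpC, hqC, hqR, hRq, hR1, hR2⟩ :=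
    hsa0.exists_reduced_resolvent (fun x hx => (hM x).mp hx) hu
  rw [Complex.coe_smul] at hpC hR1 hR2
  -- The reduction is applied to `t C(t)`: with `a = 0` the whole space is the kernel and the
  -- `Q`-block is empty.
  obtain ⟨U, B, hU, hB, -, -, hev⟩ := exists_analyticAt_unitary_reduction (p := p) (q := 1 - p)
    (Q := 0) (a := 0) (S := 0) (R := R) (C := C) (μ := μ) hC (by abel) hpp
    (by rw [mul_sub, mul_one, sub_mul, one_mul, hpp, sub_self, sub_zero])
    (by rw [mul_sub, mul_one, hpp, sub_self]) (by rw [sub_mul, one_mul, hpp, sub_self])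
    (by simp) (by simp) (by simp) (by simp) (by simp) (by simp) (by simp) (by simp)
    hpC hqC hqR hRq hR1 hR2 hp
    (hsa.mono fun t ht => by rw [zero_add]; exact (IsSelfAdjoint.all t).smul ht)
  -- The reduction gives this identity multiplied by `t`; it is divided out off `0` and extended by
  -- continuity.
  have hCU : (fun t => C t * U t * p) =ᶠ[𝓝 0] fun t => U t * B t := by
    refine (ContinuousAt.eventuallyEq_nhds_iff_eventuallyEq_nhdsNE
      ((hC.mul hU).mul analyticAt_const).continuousAt (hU.mul hB).continuousAt).mp ?_
    filter_upwards [nhdsWithin_le_nhds hev, self_mem_nhdsWithin] with t ht ht0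
    have h := ht.2.2.2.2.2
    rw [zero_add, smul_mul_assoc, smul_mul_assoc] at h
    exact smul_right_injective _ ht0 h
  refine ⟨U, hU, ?_⟩
  filter_upwards [hev, hCU, hsa] with t ⟨hU1, hU2, _, _, hBs, _⟩ hCU hsa
  refine ⟨hU1, hU2, ?_⟩
  have h1 : star (U t) * C t * U t * p = B t := by
    rw [mul_assoc, mul_assoc, ← mul_assoc (C t), hCU, ← mul_assoc, hU1, one_mul]
  have h2 : p * (star (U t) * C t * U t) = B t := by
    have := congrArg star h1
    rwa [star_mul, hp.star_eq, hBs.star_eq, (hsa.conjugate' (U t)).star_eq] at this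
  exact h2.trans h1.symm

end Rellich

/-- Rellich's theorem: an analytic family of self-adjoint operators on a finite-dimensional space
has an analytic orthonormal basis of eigenvectors. -/
theorem exists_analyticAt_orthonormal_eigenvectors (n : ℕ) : ∀ (E : Type*) [NormedAddCommGroup E]
    [InnerProductSpace ℂ E] [CompleteSpace E] [FiniteDimensional ℂ E], Module.finrank ℂ E = n →
    ∀ T : ℝ → E →L[ℂ] E, AnalyticAt ℝ T 0 → (∀ᶠ t in 𝓝 0, IsSelfAdjoint (T t)) →
    ∃ (ι : Type) (_ : Fintype ι) (x : ι → ℝ → E), Fintype.card ι = n ∧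
      (∀ i, AnalyticAt ℝ (x i) 0) ∧ ∀ᶠ t in 𝓝 0, Orthonormal ℂ (fun i => x i t) ∧
        ∀ i, ∃ c : ℂ, T t (x i t) = c • x i t := by
  induction n using Nat.strong_induction_on with
  | _ n ih =>
  intro E _ _ _ _ hn T hT hsa
  rcases Nat.eq_zero_or_pos n with rfl | hpos
  · exact ⟨Empty, inferInstance, fun i => i.elim, rfl, fun i => i.elim,
      Eventually.of_forall fun t => ⟨⟨fun i => i.elim, fun i => i.elim⟩, fun i => i.elim⟩⟩
  have : Nontrivial E := Module.finrank_pos_iff (R := ℂ).mp (hn ▸ hpos)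
  obtain ⟨e, he⟩ := exists_norm_eq E (zero_le_one (α := ℝ))
  -- Subtracting this scalar gives the family zero expectation at `e`. Unless it vanishes near `0`,
  -- dividing by the highest power of `t` leaves `C(0) ≠ 0` with `⟨e, C(0) e⟩ = 0`, so `C(0)` is not
  -- scalar and its eigenspaces are proper. Splitting along one of them lowers the dimension.
  let τ : ℝ → ℝ := fun t => RCLike.re (inner ℂ e (T t e))
  have hτ : AnalyticAt ℝ τ 0 := by
    have h1 : AnalyticAt ℝ (fun t => T t e) 0 := hT.complexCLM_apply analyticAt_const
    have h2 : AnalyticAt ℝ (fun t => innerSL ℂ e (T t e)) 0 :=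
      AnalyticAt.complexCLM_apply (U := fun _ => innerSL ℂ e) analyticAt_const h1
    exact AnalyticAt.fun_comp (Complex.reCLM.analyticAt _) h2
  have hT' : AnalyticAt ℝ (fun t => T t - τ t • (1 : E →L[ℂ] E)) 0 :=
    hT.sub (hτ.smul analyticAt_const)
  by_cases hzero : ∀ᶠ t in 𝓝 0, T t - τ t • (1 : E →L[ℂ] E) = 0
  · refine ⟨Fin n, inferInstance, fun i _ => stdOrthonormalBasis ℂ E (finCongr hn.symm i), by simp,
      fun i => analyticAt_const, ?_⟩
    filter_upwards [hzero] with t ht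
    refine ⟨(stdOrthonormalBasis ℂ E).orthonormal.comp _ (finCongr hn.symm).injective, fun i =>
      ⟨τ t, ?_⟩⟩
    rw [sub_eq_zero.mp ht]
    simp
  obtain ⟨m, C, hC, hC0, hCT⟩ := hT'.exists_eventuallyEq_pow_smul_nonzero_iff.mpr hzero
  simp only [sub_zero] at hCT
  have hCsa : ∀ᶠ t in 𝓝 0, IsSelfAdjoint (C t) := by
    refine (ContinuousAt.eventuallyEq_nhds_iff_eventuallyEq_nhdsNE (f := fun t => star (C t))
      (g := C) hC.continuousAt.star hC.continuousAt).mp ?_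
    filter_upwards [nhdsWithin_le_nhds hCT, nhdsWithin_le_nhds hsa, self_mem_nhdsWithin]
      with t ht hs ht0
    have h1 : IsSelfAdjoint (t ^ m • C t) :=
      ht ▸ hs.sub ((IsSelfAdjoint.all (τ t)).smul (.one _))
    have h2 := (IsSelfAdjoint.all (t ^ m)⁻¹).smul h1
    rw [smul_smul, inv_mul_cancel₀ (pow_ne_zero m ht0), one_smul] at h2
    exact h2
  have hCe : RCLike.re (inner ℂ e (C 0 e)) = 0 := by
    have hc : ContinuousAt (fun t => RCLike.re (inner ℂ e (C t e))) 0 :=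
      RCLike.continuous_re.continuousAt.comp
        (continuousAt_const.inner (hC.complexCLM_apply analyticAt_const).continuousAt)
    refine ((hc.eventuallyEq_nhds_iff_eventuallyEq_nhdsNE (g := fun _ => (0 : ℝ))
      continuousAt_const).mp ?_).self_of_nhds
    filter_upwards [nhdsWithin_le_nhds hCT, self_mem_nhdsWithin] with t ht ht0
    have h1 : RCLike.re (inner ℂ e ((t ^ m • C t) e)) = 0 := by
      rw [← ht]
      simp [τ, he]
    rw [smul_apply, ← Complex.coe_smul, inner_smul_right, RCLike.re_to_complex,
      Complex.re_ofReal_mul] at h1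
    exact (mul_eq_zero.mp h1).resolve_left (pow_ne_zero m ht0)
  obtain ⟨z, hz⟩ := Module.End.exists_eigenvalue (C 0 : E →ₗ[ℂ] E)
  obtain ⟨μ, rfl⟩ : ∃ μ : ℝ, (μ : ℂ) = z := Complex.conj_eq_iff_real.mp
    ((ContinuousLinearMap.isSelfAdjoint_iff_isSymmetric.mp
      hCsa.self_of_nhds).conj_eigenvalue_eq_self hz) |>.imp fun _ h => h.symm
  set M := Module.End.eigenspace (C 0 : E →ₗ[ℂ] E) (μ : ℂ)
  have hM : ∀ x, x ∈ M ↔ C 0 x = (μ : ℂ) • x := fun x => Module.End.mem_eigenspace_iff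
  have hMbot : M ≠ ⊥ := hz
  have hMtop : M ≠ ⊤ := by
    intro h
    have h1 : ∀ x, C 0 x = (μ : ℂ) • x := fun x => (hM x).mp (h ▸ Submodule.mem_top)
    rw [h1, inner_smul_right] at hCe
    have hμ : μ = 0 := by simpa [he] using hCe
    exact hC0 (ContinuousLinearMap.ext fun x => by simp [h1, hμ])
  have hsum := Submodule.finrank_add_finrank_orthogonal M
  have h1 : Module.finrank ℂ M < n := hn ▸ Submodule.finrank_lt hMtop
  have h2 : Module.finrank ℂ Mᗮ < n := by
    have : 0 < Module.finrank ℂ M := Submodule.one_le_finrank_iff.mpr hMbot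
    omega
  obtain ⟨U, hU, hUev⟩ := exists_analyticAt_unitary_commute hC hCsa μ M hM
  let D : ℝ → E →L[ℂ] E := fun t => star (U t) * C t * U t
  have hD : AnalyticAt ℝ D 0 := (hU.star_real.mul hC).mul hU
  have hDsa : ∀ᶠ t in 𝓝 0, IsSelfAdjoint (D t) := hCsa.mono fun t ht => ht.conjugate' (U t)
  obtain ⟨ι, _, y, hι, hy, hyev⟩ := ih _ h1 M rfl (fun t => compression M (D t))
    (hD.clm_conj M.subtypeL M.orthogonalProjectionOnto) (hDsa.mono fun t ht => ht.compression)
  obtain ⟨κ, _, w, hκ, hw, hwev⟩ := ih _ h2 Mᗮ rfl (fun t => compression Mᗮ (D t))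
    (hD.clm_conj Mᗮ.subtypeL Mᗮ.orthogonalProjectionOnto) (hDsa.mono fun t ht => ht.compression)
  refine ⟨ι ⊕ κ, inferInstance, Sum.elim (fun i t => U t (y i t)) (fun i t => U t (w i t)), ?_, ?_, ?_⟩
  · rw [Fintype.card_sum, hι, hκ, hsum, hn]
  · rintro (i | i)
    · exact hU.complexCLM_apply (AnalyticAt.complexCLM_apply (U := fun _ => M.subtypeL)
        analyticAt_const (hy i))
    · exact hU.complexCLM_apply (AnalyticAt.complexCLM_apply (U := fun _ => Mᗮ.subtypeL)
        analyticAt_const (hw i))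
  filter_upwards [hyev, hwev, hUev, hCT] with t ⟨hyo, hye⟩ ⟨hwo, hwe⟩ ⟨hU1, hU2, hcomm⟩ hCT
  have hTt : T t = τ t • (1 : E →L[ℂ] E) + t ^ m • C t := by rw [← hCT]; abel
  have key : ∀ v c, D t v = (c : ℂ) • v → ∃ c' : ℂ, T t (U t v) = c' • U t v := by
    intro v c hv
    have h3 : C t (U t v) = c • U t v := by
      have h4 : U t * D t = C t * U t := by
        simp only [D, ← mul_assoc, hU2, one_mul]
      have h5 : U t (D t v) = C t (U t v) := congrArg (fun S : E →L[ℂ] E => S v) h4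
      rw [← h5, hv, map_smul]
    refine ⟨τ t + (t ^ m : ℝ) * c, ?_⟩
    rw [hTt, add_smul, mul_smul, Complex.coe_smul, Complex.coe_smul, ← h3]
    rfl
  have hcomm' : ∀ v, M.starProjection (D t v) = D t (M.starProjection v) := fun v =>
    congrArg (fun S : E →L[ℂ] E => S v) hcomm.eq
  refine ⟨?_, ?_⟩
  · have := (hyo.sumElim_orthogonal hwo).of_star_mul_self hU1
    convert this using 2 with i
    rcases i with i | i <;> rfl
  · rintro (i | i)
    · obtain ⟨c, hc⟩ := hye i
      refine key _ c ?_
      have := congrArg (Subtype.val) hc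
      rw [coe_compression_apply] at this
      simpa [hcomm', mul_apply_eq_comp] using this
    · obtain ⟨c, hc⟩ := hwe i
      refine key _ c ?_
      have := congrArg (Subtype.val) hc
      rw [coe_compression_apply] at this
      have hwm : M.starProjection (w i t : E) = 0 :=
        M.starProjection_apply_eq_zero_iff.mpr (w i t).2
      simpa [hcomm', mul_apply_eq_comp, Submodule.starProjection_orthogonal', hwm] using this

/-! ### Operators on a subspace as elements of the full operator algebra -/

section Corner

variable {H : Type*} [NormedAddCommGroup H] [InnerProductSpace ℂ H]
  (K : Submodule ℂ H) [K.HasOrthogonalProjection]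

/-- The extension by zero on `Kᗮ` of an operator on `K`. -/
noncomputable def corner (X : K →L[ℂ] K) : H →L[ℂ] H :=
  K.subtypeL ∘L X ∘L K.orthogonalProjectionOnto

theorem corner_apply (X : K →L[ℂ] K) (x : H) :
    corner K X x = (X (K.orthogonalProjectionOnto x) : H) := rfl

/-- This translates block conditions on `a 1` in the full algebra into conditions on its compression
to the kernel. -/
theorem corner_mul_mul (X Y : K →L[ℂ] K) (T : H →L[ℂ] H) :
    corner K X * T * corner K Y = corner K (X * compression K T * Y) := rfl

theorem corner_mul (X Y : K →L[ℂ] K) : corner K X * corner K Y = corner K (X * Y) := by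
  ext x
  simp [corner_apply]

theorem corner_sub (X Y : K →L[ℂ] K) : corner K (X - Y) = corner K X - corner K Y := by
  ext x
  simp [corner_apply]

theorem corner_smul (c : ℂ) (X : K →L[ℂ] K) : corner K (c • X) = c • corner K X := by
  ext x
  simp [corner_apply]

theorem corner_zero : corner K 0 = 0 := by
  ext x
  simp [corner_apply]

theorem corner_one : corner K 1 = K.starProjection := rfl

theorem IsSelfAdjoint.corner [CompleteSpace H] [CompleteSpace K] {X : K →L[ℂ] K}
    (hX : IsSelfAdjoint X) : IsSelfAdjoint (corner K X) := by
  rw [ContinuousLinearMap.isSelfAdjoint_iff_isSymmetric]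
  intro x y
  change inner ℂ (X (K.orthogonalProjectionOnto x) : H) y
    = inner ℂ x (X (K.orthogonalProjectionOnto y) : H)
  rw [← K.inner_orthogonalProjectionOnto_eq_of_mem_left,
    ← K.inner_orthogonalProjectionOnto_eq_of_mem_right, hX.inner_apply_eq]

end Corner

/-! ### Eigenvectors and eigenvalues from the reduced family -/

theorem apply_eq_smul_of_reduction {H : Type*} [NormedAddCommGroup H] [InnerProductSpace ℂ H]
    [CompleteSpace H] {A U B p : H →L[ℂ] H} {t : ℝ} {v : H} {c : ℂ} (hpB : p * B = B)
    (hB : IsSelfAdjoint B) (hA : A * U * p = t • (U * B)) (hpv : p v = v) (hv : ‖v‖ = 1)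
    (hc : p (B v) = c • v) :
    A (U v) = ((t * RCLike.re (inner ℂ v (B v)) : ℝ) : ℂ) • U v := by
  have hBv : B v = c • v := by rwa [← mul_apply_eq_comp, hpB] at hc
  have hinner : inner ℂ v (B v) = c := by
    rw [hBv, inner_smul_right, inner_self_eq_norm_sq_to_K, hv]; simp
  have hreal : ((RCLike.re (inner ℂ v (B v)) : ℝ) : ℂ) = c := by
    have h1 := hB.inner_apply_eq v v
    rw [← inner_conj_symm, hinner] at h1
    rw [hinner]
    exact Complex.conj_eq_iff_re.mp h1
  have h2 : A (U (p v)) = t • U (B v) := congrArg (fun S : H →L[ℂ] H => S v) hA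
  rw [hpv, hBv, map_smul] at h2
  rw [h2, Complex.ofReal_mul, hreal, mul_smul, Complex.coe_smul]

/-- Analytic orthonormal eigenvectors of a family that is reduced by unitaries `U t` to a
finite-dimensional subspace, given as the range of the isometry `J` with adjoint `P`. -/
theorem exists_eigenvectors_of_reduction {H G : Type*} [NormedAddCommGroup H]
    [InnerProductSpace ℂ H] [CompleteSpace H] [NormedAddCommGroup G] [InnerProductSpace ℂ G]
    [CompleteSpace G] [FiniteDimensional ℂ G] (J : G →ₗᵢ[ℂ] H) (P : H →L[ℂ] G)
    (hJP : ∀ x y, inner ℂ (P x) y = inner ℂ x (J y)) {k : ℕ} (hk : Module.finrank ℂ G = k)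
    {A U B : ℝ → H →L[ℂ] H} {μ : ℝ} (hU : AnalyticAt ℝ U 0) (hB : AnalyticAt ℝ B 0)
    (hB0 : B 0 = μ • (J.toContinuousLinearMap ∘L P))
    (hUB : ∀ᶠ t in 𝓝 0, star (U t) * U t = 1 ∧ (J.toContinuousLinearMap ∘L P) * B t = B t ∧
      IsSelfAdjoint (B t) ∧ A t * U t * (J.toContinuousLinearMap ∘L P) = t • (U t * B t)) :
    ∃ (x : Fin k → ℝ → H) (eig : Fin k → ℝ → ℝ), (∀ j, AnalyticAt ℝ (x j) 0) ∧
      (∀ᶠ t in 𝓝 0, (Orthonormal ℂ fun j => x j t) ∧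
        ∀ j, A t (x j t) = (eig j t : ℂ) • x j t) ∧
      (∀ j, eig j 0 = 0) ∧ ∀ j, HasDerivAt (eig j) μ 0 := by
  have hPJ : ∀ y, P (J y) = y := fun y => ext_inner_right ℂ fun w => by
    rw [hJP, J.inner_map_map]
  obtain ⟨ι, _, y, hι, hy, hyev⟩ := exists_analyticAt_orthonormal_eigenvectors k G hk
    (fun t => P ∘L B t ∘L J.toContinuousLinearMap) (hB.clm_conj J.toContinuousLinearMap P)
    (hUB.mono fun t ht => by
      rw [ContinuousLinearMap.isSelfAdjoint_iff_isSymmetric]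
      intro u w
      change inner ℂ (P (B t (J u))) w = inner ℂ u (P (B t (J w)))
      rw [hJP, ht.2.2.1.inner_apply_eq, ← inner_conj_symm, ← hJP, inner_conj_symm])
  let σ : Fin k ≃ ι := (Fintype.equivFinOfCardEq hι).symm
  let v : Fin k → ℝ → H := fun j t => J (y (σ j) t)
  have hv : ∀ j, AnalyticAt ℝ (v j) 0 := fun j =>
    AnalyticAt.complexCLM_apply (U := fun _ => J.toContinuousLinearMap) analyticAt_const (hy (σ j))
  -- Rellich's theorem supplies eigenvalues only pointwise in `t`; the Rayleigh quotient recovers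
  -- them by a formula that is visibly differentiable.
  let g : Fin k → ℝ → ℝ := fun j t => RCLike.re (inner ℂ (v j t) (B t (v j t)))
  have hpv : ∀ j t, (J.toContinuousLinearMap ∘L P) (v j t) = v j t := fun j t =>
    congrArg J (hPJ _)
  have hvo : ∀ᶠ t in 𝓝 0, Orthonormal ℂ fun j => v j t := by
    filter_upwards [hyev] with t ht
    exact (ht.1.comp_linearIsometry J).comp σ σ.injective
  have hg : ∀ j, DifferentiableAt ℝ (g j) 0 := fun j =>
    Complex.reCLM.differentiableAt.comp 0 ((hv j).differentiableAt.inner ℂ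
      (hB.complexCLM_apply (hv j)).differentiableAt)
  have hg0 : ∀ j, g j 0 = μ := fun j => by
    have h1 : B 0 (v j 0) = μ • v j 0 := by
      rw [hB0, smul_apply, hpv]
    have h2 : ‖v j 0‖ = 1 := hvo.self_of_nhds.1 j
    simp only [g, h1]
    rw [← Complex.coe_smul, inner_smul_right, inner_self_eq_norm_sq_to_K, h2]
    simp
  refine ⟨fun j t => U t (v j t), fun j t => t * g j t, fun j => hU.complexCLM_apply (hv j), ?_,
    fun j => zero_mul _, fun j => ?_⟩
  · filter_upwards [hvo, hUB, hyev] with t hvt ⟨hU1, hpB, hBs, hAU⟩ ⟨_, hyt⟩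
    refine ⟨hvt.of_star_mul_self hU1, fun j => ?_⟩
    obtain ⟨c, hc⟩ := hyt (σ j)
    refine apply_eq_smul_of_reduction hpB hBs hAU (hpv j t) (hvt.1 j) (c := c) ?_
    have h3 : J (P (B t (v j t))) = J (c • y (σ j) t) := congrArg J hc
    rw [map_smul] at h3
    exact h3
  · exact ((hasDerivAt_id' (0 : ℝ)).fun_mul (hg j).hasDerivAt).congr_deriv (by simp [hg0])

/-- The eigenspace is a subspace of the kernel, itself a subspace of `H`; the two inclusions compose
to one isometry whose adjoint is the composite of the two projections. -/
theorem exists_eigenvectors_of_nested_reduction {H G : Type*} [NormedAddCommGroup H]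
    [InnerProductSpace ℂ H] [CompleteSpace H] [NormedAddCommGroup G] [InnerProductSpace ℂ G]
    (J : G →ₗᵢ[ℂ] H) (P : H →L[ℂ] G)
    (hJP : ∀ x y, inner ℂ (P x) y = inner ℂ x (J y)) (N : Submodule ℂ G) [FiniteDimensional ℂ N]
    {k : ℕ} (hk : Module.finrank ℂ N = k)
    {A U B : ℝ → H →L[ℂ] H} {μ : ℝ} (hU : AnalyticAt ℝ U 0) (hB : AnalyticAt ℝ B 0)
    (hB0 : B 0 = μ • (J.toContinuousLinearMap ∘L N.starProjection ∘L P))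
    (hUB : ∀ᶠ t in 𝓝 0, star (U t) * U t = 1 ∧
      (J.toContinuousLinearMap ∘L N.starProjection ∘L P) * B t = B t ∧ IsSelfAdjoint (B t) ∧
      A t * U t * (J.toContinuousLinearMap ∘L N.starProjection ∘L P) = t • (U t * B t)) :
    ∃ (x : Fin k → ℝ → H) (eig : Fin k → ℝ → ℝ), (∀ j, AnalyticAt ℝ (x j) 0) ∧
      (∀ᶠ t in 𝓝 0, (Orthonormal ℂ fun j => x j t) ∧
        ∀ j, A t (x j t) = (eig j t : ℂ) • x j t) ∧
      (∀ j, eig j 0 = 0) ∧ ∀ j, HasDerivAt (eig j) μ 0 :=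
  exists_eigenvectors_of_reduction (J.comp N.subtypeₗᵢ) (N.orthogonalProjectionOnto ∘L P)
    (fun x y => (N.inner_orthogonalProjectionOnto_eq_of_mem_right y (P x)).trans (hJP x y))
    hk hU hB hB0 hUB

/-! ### Application to the power series family -/

namespace IsSelfAdjointHolomorphicFamily

variable {H : Type*} [NormedAddCommGroup H] [InnerProductSpace ℂ H] [CompleteSpace H]
  {A : ℝ → H →L[ℂ] H} {a : ℕ → H →L[ℂ] H} {r : ℝ}

theorem isSelfAdjoint_apply (hA : IsSelfAdjointHolomorphicFamily A a r) {t : ℝ} (ht : |t| < r) :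
    IsSelfAdjoint (A t) := by
  have h := (hA.hasSum t ht).star
  have h2 : (fun n => star (t ^ n • a n)) = fun n => t ^ n • a n := by
    ext1 n
    exact ((IsSelfAdjoint.all (t ^ n)).smul (hA.selfAdjoint n)).star_eq
  rw [h2] at h
  exact h.unique (hA.hasSum t ht)

theorem hasFPowerSeriesAt (hA : IsSelfAdjointHolomorphicFamily A a r) :
    HasFPowerSeriesAt A (fun n => ContinuousMultilinearMap.mkPiRing ℝ (Fin n) (a n)) 0 := by
  refine hasFPowerSeriesAt_iff.mpr ?_
  have : ∀ᶠ t in 𝓝 (0 : ℝ), |t| < r :=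
    (continuous_abs.tendsto' 0 0 abs_zero).eventually (gt_mem_nhds hA.radius_pos)
  filter_upwards [this] with t ht
  simpa [FormalMultilinearSeries.coeff] using hA.hasSum t ht

theorem apply_zero (hA : IsSelfAdjointHolomorphicFamily A a r) : A 0 = a 0 := by
  have h1 := hA.hasSum 0 (by simpa using hA.radius_pos)
  have h2 : HasSum (fun n => (0 : ℝ) ^ n • a n) (a 0) := by
    convert hasSum_single 0 (fun n hn => ?_)
    · simp
    · simp [hn]
  exact h1.unique h2

theorem dslope_zero (hA : IsSelfAdjointHolomorphicFamily A a r) : dslope A 0 0 = a 1 := by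
  rw [dslope_same, hA.hasFPowerSeriesAt.hasDerivAt.deriv]
  simp

theorem apply_eq_add_smul_dslope (hA : IsSelfAdjointHolomorphicFamily A a r) (t : ℝ) :
    A t = a 0 + t • dslope A 0 t := by
  have h := sub_smul_dslope A 0 t
  rw [sub_zero, hA.apply_zero] at h
  rw [h, add_sub_cancel]

/-- Reduction of the family to the eigenspace `N` of the compression of `a 1` to the kernel of
`a 0`. -/
theorem exists_unitary_reduction (hA : IsSelfAdjointHolomorphicFamily A a r)
    (h0 : IsIsolatedElement (0 : ℂ) (spectrum ℂ (a 0)))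
    (K : Submodule ℂ H) [K.HasOrthogonalProjection] [CompleteSpace K] (hK : ∀ x, x ∈ K ↔ a 0 x = 0)
    {μ : ℝ} (hμ : IsIsolatedElement (μ : ℂ) (spectrum ℂ (compression K (a 1))))
    (N : Submodule ℂ K) [N.HasOrthogonalProjection]
    (hN : ∀ x, x ∈ N ↔ compression K (a 1) x = (μ : ℂ) • x) :
    ∃ U B : ℝ → H →L[ℂ] H, AnalyticAt ℝ U 0 ∧ AnalyticAt ℝ B 0 ∧
      B 0 = μ • corner K N.starProjection ∧
      ∀ᶠ t in 𝓝 0, star (U t) * U t = 1 ∧ corner K N.starProjection * B t = B t ∧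
        IsSelfAdjoint (B t) ∧ A t * U t * corner K N.starProjection = t • (U t * B t) := by
  set e := N.starProjection
  set T := compression K (a 1)
  have hee : e * e = e := N.isIdempotentElem_starProjection
  have hT : IsSelfAdjoint T := (hA.selfAdjoint 1).compression
  obtain ⟨S, hS1, hS2, hS3, hS4⟩ : ∃ S, a 0 * S = 1 - K.starProjection ∧
      S * a 0 = 1 - K.starProjection ∧ K.starProjection * S = 0 ∧ S * K.starProjection = 0 := by
    refine exists_corner_inverse K.isIdempotentElem_starProjection
      (mul_starProjection_eq_zero fun x hx => (hK x).mp hx)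
      ((hA.selfAdjoint 0).starProjection_mul_eq_zero fun x hx => (hK x).mp hx) ?_
    have := (hA.selfAdjoint 0).isUnit_sub_add_starProjection (z := 0) (by simpa using h0) K
      (fun x => by simp [hK])
    simpa using this
  obtain ⟨s, hpC, hqC, hs1, hs2, hs3, hs4⟩ := hT.exists_reduced_resolvent (fun x hx => (hN x).mp hx)
    (hT.isUnit_sub_add_starProjection hμ N hN)
  have hq : (1 - e) * (1 - e) = 1 - e := by
    rw [mul_sub, mul_one, sub_mul, one_mul, hee, sub_self, sub_zero]
  have hpq : e * (1 - e) = 0 := by rw [mul_sub, mul_one, hee, sub_self]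
  have hqp : (1 - e) * e = 0 := by rw [sub_mul, one_mul, hee, sub_self]
  have hPX : ∀ X, K.starProjection * corner K X = corner K X := fun X => by
    rw [← corner_one, corner_mul, one_mul]
  have hXP : ∀ X, corner K X * K.starProjection = corner K X := fun X => by
    rw [← corner_one, corner_mul, mul_one]
  have hXa : ∀ X, corner K X * a 0 = 0 := fun X => by
    rw [← hXP, mul_assoc,
      (hA.selfAdjoint 0).starProjection_mul_eq_zero (fun x hx => (hK x).mp hx), mul_zero]
  have haX : ∀ X, a 0 * corner K X = 0 := fun X => by
    rw [← hPX, ← mul_assoc, mul_starProjection_eq_zero (fun x hx => (hK x).mp hx), zero_mul]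
  -- `dslope A 0` is the analytic quotient `(A(t) - A₀)/t`, with value `a 1` at `0`. `S` comes from
  -- isolation of `0`, `s` from isolation of `μ`.
  obtain ⟨U, B, hU, hB, -, hB0, hev⟩ := exists_analyticAt_unitary_reduction (p := corner K e)
    (q := corner K (1 - e)) (Q := 1 - K.starProjection) (a := a 0) (S := S) (R := corner K s)
    (C := dslope A 0) (μ := μ)
    hA.hasFPowerSeriesAt.has_fpower_series_dslope_fslope.analyticAt
    (by rw [corner_sub, corner_one]; abel) (by rw [corner_mul, hee]) (by rw [corner_mul, hq])
    (by rw [corner_mul, hpq, corner_zero]) (by rw [corner_mul, hqp, corner_zero])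
    (hXa _) (haX _) (hXa _) (haX _) hS1 hS2
    (by rw [sub_mul, one_mul, hS3, sub_zero]) (by rw [mul_sub, mul_one, hS4, sub_zero])
    (by rw [hA.dslope_zero, corner_mul_mul, hpC, corner_smul, Complex.coe_smul])
    (by rw [hA.dslope_zero, corner_mul_mul, hqC, corner_zero])
    (by rw [corner_mul, hs1]) (by rw [corner_mul, hs2])
    (by rw [hA.dslope_zero, corner_mul_mul, ← Complex.coe_smul, ← corner_smul, ← corner_sub,
      corner_mul, hs3])
    (by rw [hA.dslope_zero, corner_mul_mul, ← Complex.coe_smul, ← corner_smul, ← corner_sub,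
      corner_mul, hs4])
    (isSelfAdjoint_starProjection N).corner
    (by
      have : ∀ᶠ t in 𝓝 (0 : ℝ), |t| < r :=
        (continuous_abs.tendsto' 0 0 abs_zero).eventually (gt_mem_nhds hA.radius_pos)
      filter_upwards [this] with t ht
      rw [← hA.apply_eq_add_smul_dslope]
      exact hA.isSelfAdjoint_apply ht)
  refine ⟨U, B, hU, hB, hB0, hev.mono fun t ⟨h1, _, h3, _, h5, h6⟩ => ⟨h1, h3, h5, ?_⟩⟩
  rw [hA.apply_eq_add_smul_dslope]
  exact h6

/-- Analytic orthonormal eigenvectors of the family over the eigenspace `N` of the compression of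
`a 1` to the kernel `K` of `a 0`. -/
theorem exists_analytic_eigenvectors (hA : IsSelfAdjointHolomorphicFamily A a r)
    (h0 : IsIsolatedElement (0 : ℂ) (spectrum ℂ (a 0)))
    (K : Submodule ℂ H) [K.HasOrthogonalProjection] [CompleteSpace K] (hK : ∀ x, x ∈ K ↔ a 0 x = 0)
    {μ : ℝ} (hμ : IsIsolatedElement (μ : ℂ) (spectrum ℂ (compression K (a 1))))
    (N : Submodule ℂ K) [FiniteDimensional ℂ N]
    (hN : ∀ x, x ∈ N ↔ compression K (a 1) x = (μ : ℂ) • x) {k : ℕ} (hk : Module.finrank ℂ N = k) :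
    ∃ α β : ℝ, α < 0 ∧ 0 < β ∧ Ioo α β ⊆ Ioo (-r) r ∧
      ∃ (x : Fin k → ℝ → H) (eig : Fin k → ℝ → ℝ),
        (∀ j, AnalyticOnNhd ℝ (x j) (Ioo α β)) ∧
        (∀ t ∈ Ioo α β, Orthonormal ℂ fun j => x j t) ∧
        (∀ t ∈ Ioo α β, ∀ j, A t (x j t) = (eig j t : ℂ) • x j t) ∧
        (∀ j, eig j 0 = 0) ∧
        (∀ j, HasDerivAt (eig j) μ 0) := by
  obtain ⟨U, B, hU, hB, hB0, hUB⟩ := hA.exists_unitary_reduction h0 K hK hμ N hN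
  obtain ⟨x, eig, hx, hev, he0, hed⟩ := exists_eigenvectors_of_nested_reduction K.subtypeₗᵢ
    K.orthogonalProjectionOnto (fun x y => K.inner_orthogonalProjectionOnto_eq_of_mem_right y x)
    N hk hU hB hB0 hUB
  have hmain := (eventually_all.mpr fun j => (hx j).eventually_analyticAt).and hev
  obtain ⟨ε, hε, hball⟩ := Metric.eventually_nhds_iff.mp hmain
  have hmem : ∀ t ∈ Ioo (-min ε r) (min ε r), dist t 0 < ε := fun t ht => by
    rw [Real.dist_0_eq_abs, abs_lt]
    exact ⟨(neg_le_neg (min_le_left _ _)).trans_lt ht.1, ht.2.trans_le (min_le_left _ _)⟩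
  have hpos : 0 < min ε r := lt_min hε hA.radius_pos
  refine ⟨-min ε r, min ε r, neg_lt_zero.mpr hpos, hpos,
    Ioo_subset_Ioo (neg_le_neg (min_le_right _ _)) (min_le_right _ _),
    x, eig, fun j t ht => (hball (hmem t ht)).1 j, fun t ht => (hball (hmem t ht)).2.1,
    fun t ht => (hball (hmem t ht)).2.2, he0, hed⟩

end IsSelfAdjointHolomorphicFamily

theorem theorem5p1 {H : Type*} [NormedAddCommGroup H] [InnerProductSpace ℂ H] [CompleteSpace H]
    (A : ℝ → H →L[ℂ] H) (a : ℕ → H →L[ℂ] H) (r : ℝ)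
    (hA : IsSelfAdjointHolomorphicFamily A a r)
    (h0 : IsIsolatedElement (0 : ℂ) (spectrum ℂ (a 0)))
    (μ : ℝ) (k : ℕ)
    (hμ : IsDiscreteEigenvalue (compression (a 0).ker (a 1)) (μ : ℂ) k) :
    ∃ α β : ℝ, α < 0 ∧ 0 < β ∧ Ioo α β ⊆ Ioo (-r) r ∧
      ∃ (x : Fin k → ℝ → H) (eig : Fin k → ℝ → ℝ),
        (∀ j, AnalyticOnNhd ℝ (x j) (Ioo α β)) ∧
        (∀ t ∈ Ioo α β, Orthonormal ℂ fun j => x j t) ∧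
        (∀ t ∈ Ioo α β, ∀ j, A t (x j t) = (eig j t : ℂ) • x j t) ∧
        (∀ j, eig j 0 = 0) ∧
        (∀ j, HasDerivAt (eig j) μ 0) := by
  have := hμ.finiteDimensional
  exact hA.exists_analytic_eigenvectors h0 (a 0).ker (fun x => LinearMap.mem_ker) hμ.isolated
    (Module.End.eigenspace (compression (a 0).ker (a 1) : (a 0).ker →ₗ[ℂ] (a 0).ker) (μ : ℂ))
    (fun x => Module.End.mem_eigenspace_iff) hμ.finrank_eq
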